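/- For a finite connected simple graph $G$ with at least one edge, let $\mathscr K(G)=\sum_j \pi_j m_{ij}$ be Kemeny's constant of the simple random walk on $G$, where $\pi$ is the stationary distribution and $m_{ij}$ is the expected hitting time of $j$ from $i$ (so $m_{jj}=0$); the sum does not depend on the initial vertex $i$. For a one-vertex graph the walk is taken to stay at its only vertex, so that $\mathscr K=0$. Let $r_G(i,j)=(e_i-e_j)^T L^\dagger (e_i-e_j)$ be the effective resistance between $i$ and $j$, where $L^\dagger$ is the Moore–Penrose pseudoinverse of the Laplacian matrix of $G$, and let $\mu(G,v)=\sum_{i\in V(G)} d_i\, r_G(i,v)$ be the moment of $G$ at $v$, where $d_i$ is the degree of $i$. **Theorem.** Let $G_1$ be a finite connected simple graph with $m_1=|E(G_1)|$ edges, let $v\in V(G_1)$, and let $k\ge 0$ be an integer with $m_1+k>0$. Let $G=G_1\oplus_v S_{k+1}$ be the graph obtained from $G_1$ and the star $S_{k+1}$ on $k+1$ vertices by identifying $v$ with the central vertex of $S_{k+1}$; that is, $G$ is $G_1$ with $k$ pendant vertices attached at $v$. Then $$\mathscr K(G)=\frac{m_1\,\mathscr K(G_1)+k\,\mu(G_1,v)+k\left(m_1+k-\tfrac12\right)}{m_1+k}.$$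 In particular, both Kemeny's constants are well defined. -/

import Mathlib

open scoped ENNReal Matrix

noncomputable section

namespace Kemeny

/-! ### The simple random walk, hitting times and Kemeny's constant -/

open Classical in
/-- One step of the simple random walk on `G`: from `x` the walker moves to a uniformly chosen
neighbour of `x`. At a vertex without neighbours (in a connected graph this happens only when the
graph has a single vertex) the walker stays where it is. -/
def walkStep {V : Type*} [Fintype V] (G : SimpleGraph V) (x : V) : PMF V :=
  if h : (G.neighborFinset x).Nonempty then PMF.uniformOfFinset (G.neighborFinset x) h
  else PMF.pure x

/-- The law of the trajectory `[X₀, X₁, …, Xₙ]` of the random walk on `G` with `X₀ = i`. -/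
def walkLaw {V : Type*} [Fintype V] (G : SimpleGraph V) : ℕ → V → PMF (List V)
  | 0, i => PMF.pure [i]
  | n + 1, i => (walkStep G i).bind fun x => (walkLaw G n x).map fun l => i :: l

/-- `ℙ(τ > n)`, where `τ = min {t ≥ 0 : Xₜ = j}` is the hitting time of `j` by the random walk
started at `i`: the probability that none of `X₀, …, Xₙ` is `j`. -/
def probNotHitBy {V : Type*} [Fintype V] (G : SimpleGraph V) (i j : V) (n : ℕ) : ℝ≥0∞ :=
  (walkLaw G n i).toOuterMeasure {l | j ∉ l}

/-- The expected hitting time `m_{ij} = 𝔼 τ = ∑_{n ≥ 0} ℙ(τ > n)` of `j` by the random walk started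
at `i` (so `m_{jj} = 0`). It is `∞` if the walk fails to reach `j` with positive probability. -/
def hitTime {V : Type*} [Fintype V] (G : SimpleGraph V) (i j : V) : ℝ≥0∞ :=
  ∑' n : ℕ, probNotHitBy G i j n

/-- `π` is a stationary distribution of the random walk on `G`. -/
def IsStationary {V : Type*} [Fintype V] (G : SimpleGraph V) (π : PMF V) : Prop :=
  π.bind (walkStep G) = π

/-- `κ` is Kemeny's constant of `G`: the random walk on `G` has exactly one stationary distribution
`π`, and for every initial vertex `i` the sum `∑ j, π_j * m_{ij}` is finite and equal to `κ`. -/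
def IsKemenyConstant {V : Type*} [Fintype V] (G : SimpleGraph V) (κ : ℝ) : Prop :=
  ∃ π : PMF V, IsStationary G π ∧ (∀ π' : PMF V, IsStationary G π' → π' = π) ∧
    ∀ i : V, ∑ j, π j * hitTime G i j ≠ ∞ ∧ (∑ j, π j * hitTime G i j).toReal = κ

/-! ### Effective resistance and moment -/

/-- `X` is the Moore–Penrose pseudoinverse of the real matrix `A` (the four Penrose equations). -/
structure IsMoorePenrose {V : Type*} [Fintype V] (A X : Matrix V V ℝ) : Prop where
  mul_mul_left : A * X * A = A
  mul_mul_right : X * A * X = X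
  transpose_left : (A * X)ᵀ = A * X
  transpose_right : (X * A)ᵀ = X * A

theorem IsMoorePenrose.unique {V : Type*} [Fintype V] {A X Y : Matrix V V ℝ}
    (hX : IsMoorePenrose A X) (hY : IsMoorePenrose A Y) : X = Y := by
  have h1 : A * X = A * Y := by
    calc A * X = (A * X)ᵀ := hX.transpose_left.symm
      _ = (A * Y * (A * X))ᵀ := by rw [← Matrix.mul_assoc, hY.mul_mul_left]
      _ = (A * X)ᵀ * (A * Y)ᵀ := Matrix.transpose_mul _ _
      _ = A * X * (A * Y) := by rw [hX.transpose_left, hY.transpose_left]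
      _ = A * Y := by rw [← Matrix.mul_assoc, hX.mul_mul_left]
  have h2 : X * A = Y * A := by
    calc X * A = (X * A)ᵀ := hX.transpose_right.symm
      _ = (X * A * (Y * A))ᵀ := by rw [Matrix.mul_assoc, ← Matrix.mul_assoc A, hY.mul_mul_left]
      _ = (Y * A)ᵀ * (X * A)ᵀ := Matrix.transpose_mul _ _
      _ = Y * A * (X * A) := by rw [hX.transpose_right, hY.transpose_right]
      _ = Y * A := by rw [Matrix.mul_assoc, ← Matrix.mul_assoc A, hX.mul_mul_left]
  calc X = X * A * X := hX.mul_mul_right.symm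
    _ = Y * A * Y := by rw [h2, Matrix.mul_assoc, h1, Matrix.mul_assoc]
    _ = Y := hY.mul_mul_right

theorem exists_isMoorePenrose {V : Type*} [Fintype V] {A : Matrix V V ℝ} (hA : A.IsHermitian) :
    ∃ X : Matrix V V ℝ, IsMoorePenrose A X := by
  classical
  have hsa : IsSelfAdjoint A := hA.isSelfAdjoint
  have hc : ∀ f : ℝ → ℝ, ContinuousOn f (spectrum ℝ A) := fun f =>
    (Matrix.finite_real_spectrum (A := A)).continuousOn f
  have hid : cfc (fun x : ℝ => x) A = A := cfc_id' ℝ A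
  have hl : A * cfc (fun x : ℝ => x⁻¹) A = cfc (fun x : ℝ => x * x⁻¹) A := by
    rw [cfc_mul (fun x : ℝ => x) (fun x : ℝ => x⁻¹) A (hc _) (hc _), hid]
  have hr : cfc (fun x : ℝ => x⁻¹) A * A = cfc (fun x : ℝ => x * x⁻¹) A := by
    rw [← hl]
    have h := (cfc_commute_cfc (fun x : ℝ => x⁻¹) (fun x : ℝ => x) A).eq
    rwa [hid] at h
  have hs : (cfc (fun x : ℝ => x * x⁻¹) A)ᵀ = cfc (fun x : ℝ => x * x⁻¹) A := by
    have h : IsSelfAdjoint (cfc (fun x : ℝ => x * x⁻¹) A) := cfc_predicate _ A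
    have h' := h.star_eq
    rwa [Matrix.star_eq_conjTranspose, Matrix.conjTranspose_eq_transpose_of_trivial] at h'
  refine ⟨cfc (fun x : ℝ => x⁻¹) A, ?_, ?_, by rw [hl, hs], by rw [hr, hs]⟩
  · rw [hl]
    nth_rewrite 2 [← hid]
    rw [← cfc_mul _ _ A (hc _) (hc _)]
    simp only [mul_inv_mul_cancel]
    exact hid
  · rw [hr, ← cfc_mul _ _ A (hc _) (hc _)]
    refine cfc_congr fun x _ => ?_
    by_cases hx : x = 0 <;> simp [hx]

open Classical in
/-- The Moore–Penrose pseudoinverse `L†` of the Laplacian matrix `L` of `G`. -/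
def lapPinv {V : Type*} [Fintype V] (G : SimpleGraph V) : Matrix V V ℝ :=
  (exists_isMoorePenrose (G.isHermitian_lapMatrix ℝ)).choose

open Classical in
/-- The effective resistance `r_G(i, j) = (e_i - e_j)ᵀ L† (e_i - e_j)`. -/
def effRes {V : Type*} [Fintype V] (G : SimpleGraph V) (i j : V) : ℝ :=
  (Pi.single i 1 - Pi.single j 1 : V → ℝ) ⬝ᵥ
    (lapPinv G *ᵥ (Pi.single i 1 - Pi.single j 1 : V → ℝ))

open Classical in
/-- The moment `μ(G, v) = ∑ i, d_i r_G(i, v)`. -/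
def moment {V : Type*} [Fintype V] (G : SimpleGraph V) (v : V) : ℝ :=
  ∑ i : V, (G.degree i : ℝ) * effRes G i v

/-! ### One-sums -/

/-- The 1-sum of `G₁` and `G₂`, identifying `v₁` with `v₂`: disjoint copies of `G₁` and of `G₂`, the
vertex `v₂` is removed, and every edge `{v₂, y}` of `G₂` is replaced by `{v₁, y}`. -/
def oneSum {V₁ V₂ : Type*} (G₁ : SimpleGraph V₁) (G₂ : SimpleGraph V₂) (v₁ : V₁) (v₂ : V₂) :
    SimpleGraph (V₁ ⊕ {y : V₂ // y ≠ v₂}) where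
  Adj
    | .inl a, .inl b => G₁.Adj a b
    | .inl a, .inr y => a = v₁ ∧ G₂.Adj v₂ y
    | .inr x, .inl b => b = v₁ ∧ G₂.Adj x v₂
    | .inr x, .inr y => G₂.Adj x y
  symm := ⟨by
    rintro (a | x) (b | y) h
    · exact G₁.adj_symm h
    · exact ⟨h.1, G₂.adj_symm h.2⟩
    · exact ⟨h.1, G₂.adj_symm h.2⟩
    · exact G₂.adj_symm h⟩
  loopless := ⟨by
    rintro (a | x) h
    · exact G₁.irrefl h
    · exact G₂.irrefl h⟩

end Kemeny

end

/-! The proof rests on the identity `𝒦(G) = (∑ i j, d_i d_j r(i,j)) / (4 m)`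
(`isKemenyConstant_of_connected`). Hitting times of `j` form a potential `h` with Laplacian `d` off
`j` and `h j = 0`, so `L†` expresses them; averaging over `π_j = d_j / 2m` cancels every term
involving the starting vertex and leaves resistances.

Attaching `k` pendant vertices at `v` keeps resistances inside `G₁`, puts a leaf at distance `r(a,v)
+ 1` from `a`, and puts two leaves at distance `2`. Only the degree of `v` changes, by `k`.
Splitting the double sum accordingly (`sum_deg_mul_deg_mul_effRes`) produces the moment and the
formula. -/

namespace Kemeny

section Walk

variable {V : Type*} [Fintype V]

/-! ### The Laplacian as an operator on functions -/

open Classical in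
/-- The Laplacian of a function on the vertices: `(lap G f) i = ∑_{x ∼ i} (f i - f x)`. -/
noncomputable def lap (G : SimpleGraph V) (f : V → ℝ) (i : V) : ℝ :=
  ∑ x, if G.Adj i x then f i - f x else 0

open Classical in
/-- The degree of a vertex as a real number. -/
noncomputable def deg (G : SimpleGraph V) (i : V) : ℝ := G.degree i

open Classical in
theorem deg_eq_sum (G : SimpleGraph V) (i : V) : deg G i = ∑ x, if G.Adj i x then 1 else 0 :=
  G.degree_eq_sum_if_adj i

theorem deg_nonneg (G : SimpleGraph V) (i : V) : 0 ≤ deg G i := Nat.cast_nonneg _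

open Classical in
theorem lap_eq (G : SimpleGraph V) (f : V → ℝ) (i : V) :
    lap G f i = deg G i * f i - ∑ x, if G.Adj i x then f x else 0 := by
  rw [deg_eq_sum, Finset.sum_mul, ← Finset.sum_sub_distrib]
  refine Finset.sum_congr rfl fun x _ => ?_
  split_ifs <;> simp

open Classical in
theorem lapMatrix_mulVec (G : SimpleGraph V) (f : V → ℝ) : G.lapMatrix ℝ *ᵥ f = lap G f := by
  ext i
  rw [SimpleGraph.lapMatrix_mulVec_apply, lap_eq, deg, ← Finset.sum_filter]
  congr 2
  ext x
  simp

theorem lap_sub_const (G : SimpleGraph V) (f : V → ℝ) (c : ℝ) :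
    lap G (fun x => f x - c) = lap G f := by
  ext i
  simp [lap]

theorem lap_sub (G : SimpleGraph V) (f g : V → ℝ) (i : V) :
    lap G (fun x => f x - g x) i = lap G f i - lap G g i := by
  simp only [lap, ← Finset.sum_sub_distrib]
  refine Finset.sum_congr rfl fun x _ => ?_
  split_ifs <;> ring

theorem sum_lap (G : SimpleGraph V) (f : V → ℝ) : ∑ i, lap G f i = 0 := by
  have h : ∑ i, lap G f i = - ∑ i, lap G f i := by
    conv_lhs => simp only [lap]
    rw [Finset.sum_comm, ← Finset.sum_neg_distrib]
    refine Finset.sum_congr rfl fun x _ => ?_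
    rw [lap, ← Finset.sum_neg_distrib]
    refine Finset.sum_congr rfl fun y _ => ?_
    rw [G.adj_comm y x]
    split_ifs <;> ring
  linarith

/-- The source of uniqueness for hitting times and stationary distributions, and of the solvability
of `L f = g`. -/
theorem eq_of_lap_eq_zero {G : SimpleGraph V} (hG : G.Connected) {f : V → ℝ}
    (h : ∀ i, lap G f i = 0) (i j : V) : f i = f j := by
  classical
  refine (SimpleGraph.lapMatrix_mulVec_eq_zero_iff_forall_reachable G).1 ?_ i j (hG i j)
  ext x
  rw [Pi.zero_apply, ← h x, ← lapMatrix_mulVec]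

/-- Minimum principle: a function with positive Laplacian off `j` attains its minimum at `j`. -/
theorem le_of_lap_pos {G : SimpleGraph V} {f : V → ℝ} {j : V}
    (h : ∀ i, i ≠ j → 0 < lap G f i) (i : V) : f j ≤ f i := by
  have : Nonempty V := ⟨i⟩
  obtain ⟨x, hx⟩ := Finite.exists_min f
  by_cases hxj : x = j
  · exact hxj ▸ hx i
  · refine absurd (h x hxj) (not_lt.2 (Finset.sum_nonpos fun y _ => ?_))
    split_ifs
    · linarith [hx y]
    · exact le_rfl

/-! ### The pseudoinverse of the Laplacian -/

theorem lap_mulVec_lapPinv_identities (G : SimpleGraph V) :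
    (∀ f : V → ℝ, lap G (lapPinv G *ᵥ lap G f) = lap G f) ∧
    (∀ f : V → ℝ, lap G (lap G (lapPinv G *ᵥ f)) = lap G f) ∧
    (∀ f g : V → ℝ, lap G f ⬝ᵥ g = f ⬝ᵥ lap G g) := by
  classical
  have hX : IsMoorePenrose (G.lapMatrix ℝ) (lapPinv G) :=
    (exists_isMoorePenrose (G.isHermitian_lapMatrix ℝ)).choose_spec
  have hs : (G.lapMatrix ℝ)ᵀ = G.lapMatrix ℝ := G.isSymm_lapMatrix ℝ
  have hL : ∀ f : V → ℝ, lap G f = G.lapMatrix ℝ *ᵥ f := fun f =>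
    (lapMatrix_mulVec G f).symm
  refine ⟨fun f => ?_, fun f => ?_, fun f g => ?_⟩
  · simp only [hL, Matrix.mulVec_mulVec, ← Matrix.mul_assoc, hX.mul_mul_left]
  -- Transposing `L X L = L`, with `L` and `L X` symmetric, gives `L (L X) = L`.
  · have h3 := congrArg Matrix.transpose hX.mul_mul_left
    rw [Matrix.transpose_mul, hX.transpose_left, hs] at h3
    simp only [hL, Matrix.mulVec_mulVec, h3]
  · rw [hL, hL, Matrix.dotProduct_mulVec, ← Matrix.mulVec_transpose, hs]

/-- The defect `g - L L† g` is harmonic, hence constant, and it has sum zero. -/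
theorem lap_lapPinv {G : SimpleGraph V} (hG : G.Connected) {g : V → ℝ} (hg : ∑ i, g i = 0) :
    lap G (lapPinv G *ᵥ g) = g := by
  set w : V → ℝ := fun i => g i - lap G (lapPinv G *ᵥ g) i with hw
  have h0 : ∀ i, lap G w i = 0 := fun i => by
    rw [hw, lap_sub, (lap_mulVec_lapPinv_identities G).2.1, sub_self]
  have hs : ∑ i, w i = 0 := by rw [hw, Finset.sum_sub_distrib, hg, sum_lap, sub_zero]
  ext i
  have hc : ∑ x, w x = Fintype.card V * w i := by
    rw [Finset.sum_congr rfl fun x _ => eq_of_lap_eq_zero hG h0 x i]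
    simp
  have : Nonempty V := ⟨i⟩
  have hcard : (Fintype.card V : ℝ) ≠ 0 := Nat.cast_ne_zero.2 Fintype.card_ne_zero
  have : w i = 0 := by
    rw [hs] at hc
    exact (mul_eq_zero.1 hc.symm).resolve_left hcard
  simp only [hw] at this
  linarith

open Classical in
theorem effRes_eq (G : SimpleGraph V) (i j : V) :
    effRes G i j = lapPinv G i i + lapPinv G j j - lapPinv G i j - lapPinv G j i := by
  simp only [effRes, Matrix.mulVec_sub, sub_dotProduct, dotProduct_sub, single_one_dotProduct,
    Matrix.mulVec_single_one, Matrix.col_apply]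
  ring

theorem effRes_self (G : SimpleGraph V) (i : V) : effRes G i i = 0 := by
  rw [effRes_eq]; ring

theorem effRes_comm (G : SimpleGraph V) (i j : V) : effRes G i j = effRes G j i := by
  rw [effRes_eq, effRes_eq]; ring

open Classical in
/-- The effective resistance is the potential difference of a unit current flow. -/
theorem effRes_eq_sub {G : SimpleGraph V} {f : V → ℝ} {i j : V}
    (h : lap G f = Pi.single i 1 - Pi.single j 1) : effRes G i j = f i - f j := by
  obtain ⟨h1, -, h3⟩ := lap_mulVec_lapPinv_identities G
  have h4 : effRes G i j = lap G f ⬝ᵥ (lapPinv G *ᵥ lap G f) := by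
    rw [h, effRes]
  -- `Lf · L†Lf = f · L L† L f = f · Lf`.
  rw [h4, h3, h1, h, dotProduct_sub, dotProduct_single_one, dotProduct_single_one]

open Classical in
theorem exists_lap_eq {G : SimpleGraph V} (hG : G.Connected) (i j : V) :
    ∃ f : V → ℝ, lap G f = Pi.single i 1 - Pi.single j 1 :=
  ⟨_, lap_lapPinv hG (by simp)⟩

/-! ### Hitting times -/

theorem probNotHitBy_self (G : SimpleGraph V) (j : V) (n : ℕ) : probNotHitBy G j j n = 0 := by
  cases n with
  | zero => simp [probNotHitBy, walkLaw]
  | succ n =>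
    simp [probNotHitBy, walkLaw, PMF.toOuterMeasure_bind_apply, PMF.toOuterMeasure_map_apply]

theorem probNotHitBy_zero (G : SimpleGraph V) {i j : V} (h : i ≠ j) :
    probNotHitBy G i j 0 = 1 := by
  simp [probNotHitBy, walkLaw, h.symm]

theorem probNotHitBy_succ (G : SimpleGraph V) {i j : V} (h : i ≠ j) (n : ℕ) :
    probNotHitBy G i j (n + 1) = ∑ x, walkStep G i x * probNotHitBy G x j n := by
  simp [probNotHitBy, walkLaw, PMF.toOuterMeasure_bind_apply, PMF.toOuterMeasure_map_apply,
    tsum_fintype, h.symm]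

theorem hitTime_self (G : SimpleGraph V) (j : V) : hitTime G j j = 0 := by
  simp [hitTime, probNotHitBy_self]

theorem hitTime_of_ne (G : SimpleGraph V) {i j : V} (h : i ≠ j) :
    hitTime G i j = 1 + ∑ x, walkStep G i x * hitTime G x j := by
  rw [hitTime, tsum_eq_zero_add' ENNReal.summable, probNotHitBy_zero G h]
  simp only [probNotHitBy_succ G h, hitTime, ← ENNReal.tsum_mul_left]
  rw [Summable.tsum_finsetSum fun _ _ => ENNReal.summable]

/-- A solution of the first-step inequalities dominates the hitting times. -/
theorem hitTime_le {G : SimpleGraph V} {j : V} {H : V → ℝ≥0∞}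
    (hH : ∀ i, i ≠ j → 1 + ∑ x, walkStep G i x * H x ≤ H i) (i : V) : hitTime G i j ≤ H i := by
  rw [hitTime, ENNReal.tsum_eq_iSup_nat]
  refine iSup_le fun N => ?_
  induction N generalizing i with
  | zero => simp
  | succ N ih =>
    by_cases h : i = j
    · subst h
      simp [probNotHitBy_self]
    · rw [Finset.sum_range_succ', probNotHitBy_zero G h, add_comm]
      simp only [probNotHitBy_succ G h]
      rw [Finset.sum_comm]
      refine le_trans ?_ (hH i h)
      gcongr with x
      rw [← Finset.mul_sum]
      gcongr
      exact ih x

open Classical in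
theorem walkStep_apply {G : SimpleGraph V} {i : V} (hi : 0 < deg G i) (x : V) :
    walkStep G i x = if G.Adj i x then ENNReal.ofReal (deg G i)⁻¹ else 0 := by
  have h : (G.neighborFinset i).Nonempty := by
    rw [← Finset.card_pos]
    exact Nat.cast_pos.1 hi
  rw [walkStep, dif_pos h, PMF.uniformOfFinset_apply, ENNReal.ofReal_inv_of_pos hi]
  simp [deg]

open Classical in
theorem sum_walkStep_mul {G : SimpleGraph V} {i : V} (hi : 0 < deg G i) {f : V → ℝ}
    (hf : ∀ x, 0 ≤ f x) :
    ∑ x, walkStep G i x * ENNReal.ofReal (f x) =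
      ENNReal.ofReal ((deg G i)⁻¹ * ∑ x, if G.Adj i x then f x else 0) := by
  have hd : 0 ≤ (deg G i)⁻¹ := inv_nonneg.2 hi.le
  rw [Finset.mul_sum, ENNReal.ofReal_sum_of_nonneg]
  · refine Finset.sum_congr rfl fun x _ => ?_
    rw [walkStep_apply hi]
    split_ifs
    · rw [ENNReal.ofReal_mul hd]
    · simp
  · intro x _
    split_ifs
    · exact mul_nonneg hd (hf x)
    · simp

/-- Hitting times are determined by the first-step equations. -/
theorem hitTime_eq_ofReal {G : SimpleGraph V} (hG : G.Connected) (hd : ∀ i, 0 < deg G i) {j : V}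
    {h : V → ℝ} (hj : h j = 0) (hh : ∀ i, i ≠ j → lap G h i = deg G i) (i : V) :
    hitTime G i j = ENNReal.ofReal (h i) := by
  classical
  have h0 : ∀ i, 0 ≤ h i := fun i => hj ▸ le_of_lap_pos (fun x hx => hh x hx ▸ hd x) i
  -- Finiteness comes first: `h` dominates the hitting times, which can then be treated as real
  -- numbers.
  have hfin : ∀ i, hitTime G i j ≠ ∞ := by
    refine fun i => ne_top_of_le_ne_top ENNReal.ofReal_ne_top
      (hitTime_le (H := fun i => ENNReal.ofReal (h i)) (fun i hi => ?_) i)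
    rw [sum_walkStep_mul (hd i) h0, ← ENNReal.ofReal_one, ← ENNReal.ofReal_add zero_le_one]
    · refine ENNReal.ofReal_le_ofReal (le_of_eq ?_)
      have := hh i hi
      rw [lap_eq] at this
      have hd' := (hd i).ne'
      field_simp
      linarith
    · exact mul_nonneg (inv_nonneg.2 (hd i).le)
        (Finset.sum_nonneg fun x _ => by split_ifs <;> simp [h0])
  set T : V → ℝ := fun i => (hitTime G i j).toReal with hT
  have hTj : T j = 0 := by simp [hT, hitTime_self]
  have hT0 : ∀ i, 0 ≤ T i := fun i => ENNReal.toReal_nonneg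
  have hTT : ∀ i, hitTime G i j = ENNReal.ofReal (T i) := fun i =>
    (ENNReal.ofReal_toReal (hfin i)).symm
  have hTl : ∀ i, i ≠ j → lap G T i = deg G i := by
    intro i hi
    have hn : 0 ≤ (deg G i)⁻¹ * ∑ x, if G.Adj i x then T x else 0 :=
      mul_nonneg (inv_nonneg.2 (hd i).le)
        (Finset.sum_nonneg fun x _ => by split_ifs <;> simp [hT0])
    have h1 := hitTime_of_ne G hi
    simp only [hTT] at h1
    rw [sum_walkStep_mul (hd i) hT0, ← ENNReal.ofReal_one, ← ENNReal.ofReal_add zero_le_one hn,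
      ENNReal.ofReal_eq_ofReal_iff (hT0 i) (by positivity)] at h1
    rw [lap_eq, h1]
    have hd' := (hd i).ne'
    field_simp
    ring
  have hu : ∀ i, i ≠ j → lap G (fun x => T x - h x) i = 0 := fun i hi => by
    rw [lap_sub, hTl i hi, hh i hi, sub_self]
  -- The Laplacian of the difference has total sum zero, so vanishing off `j` forces vanishing at
  -- `j`.
  have huj : lap G (fun x => T x - h x) j = 0 := by
    rw [← sum_lap G (fun x => T x - h x)]
    exact (Finset.sum_eq_single j (fun i _ hi => hu i hi) (by simp)).symm
  have := eq_of_lap_eq_zero hG (f := fun x => T x - h x)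
    (fun i => if hi : i = j then hi ▸ huj else hu i hi) i j
  rw [hTT i]
  congr 1
  simp only [hTj, hj] at this
  linarith

/-! ### The stationary distribution -/

theorem isStationary_iff (G : SimpleGraph V) (π : PMF V) :
    IsStationary G π ↔ ∀ x, ∑ i, π i * walkStep G i x = π x := by
  simp [IsStationary, PMF.ext_iff, PMF.bind_apply, tsum_fintype]

theorem exists_stationary {G : SimpleGraph V} [Nonempty V] (hd : ∀ i, 0 < deg G i) :
    ∃ π : PMF V, IsStationary G π ∧ ∀ i, π i = ENNReal.ofReal (deg G i / ∑ x, deg G x) := by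
  classical
  have hS : 0 < ∑ x, deg G x := Finset.sum_pos (fun x _ => hd x) Finset.univ_nonempty
  have hn : ∀ i, 0 ≤ deg G i / ∑ x, deg G x := fun i => div_nonneg (deg_nonneg G i) hS.le
  refine ⟨PMF.ofFintype (fun i => ENNReal.ofReal (deg G i / ∑ x, deg G x)) ?_, ?_,
    fun i => PMF.ofFintype_apply _ _⟩
  · rw [← ENNReal.ofReal_sum_of_nonneg fun i _ => hn i, ← Finset.sum_div, div_self hS.ne',
      ENNReal.ofReal_one]
  · rw [isStationary_iff]
    intro x
    simp only [PMF.ofFintype_apply, walkStep_apply (hd _)]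
    rw [deg_eq_sum G x, Finset.sum_div, ENNReal.ofReal_sum_of_nonneg]
    · refine Finset.sum_congr rfl fun i _ => ?_
      rw [G.adj_comm]
      split_ifs
      · rw [← ENNReal.ofReal_mul (hn i)]
        congr 1
        have := (hd i).ne'
        field_simp
      · simp
    · intro i _
      split_ifs <;> positivity

theorem stationary_unique {G : SimpleGraph V} (hG : G.Connected) (hd : ∀ i, 0 < deg G i)
    {π π' : PMF V} (h : IsStationary G π) (h' : IsStationary G π') : π = π' := by
  classical
  rw [isStationary_iff] at h h'
  have key : ∀ {ρ : PMF V}, (∀ x, ∑ i, ρ i * walkStep G i x = ρ x) → ∀ i,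
      (ρ i).toReal = deg G i / ∑ x, deg G x := by
    intro ρ hρ i
    -- By reversibility, stationarity of `ρ` says that the density `ρ / d` is harmonic, hence
    -- constant; total mass one fixes the constant.
    set f : V → ℝ := fun i => (ρ i).toReal / deg G i with hf
    have hl : ∀ x, lap G f x = 0 := by
      intro x
      have h1 := congrArg ENNReal.toReal (hρ x)
      rw [ENNReal.toReal_sum fun i _ => ENNReal.mul_ne_top (PMF.apply_ne_top _ _)
        (PMF.apply_ne_top _ _)] at h1
      rw [lap_eq, hf]
      simp only [mul_div_cancel₀ _ (hd x).ne']
      rw [← h1, sub_eq_zero]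
      refine Finset.sum_congr rfl fun i _ => ?_
      rw [walkStep_apply (hd i), G.adj_comm]
      split_ifs
      · rw [ENNReal.toReal_mul, ENNReal.toReal_ofReal (inv_nonneg.2 (hd i).le), div_eq_mul_inv]
      · simp
    have hc := fun x => eq_of_lap_eq_zero hG hl x i
    have hx : ∀ x, (ρ x).toReal = deg G x * f i := fun x => by
      rw [← hc x, hf]
      have := (hd x).ne'
      field_simp
    have hs : ∑ x, (ρ x).toReal = 1 := by
      rw [← ENNReal.toReal_sum fun i _ => PMF.apply_ne_top _ _, ← tsum_fintype (L := .unconditional V), PMF.tsum_coe,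
        ENNReal.toReal_one]
    simp only [hx, ← Finset.sum_mul] at hs
    rw [hx i, eq_div_iff (left_ne_zero_of_mul_eq_one hs)]
    linear_combination deg G i * hs
  ext i
  rw [← ENNReal.toReal_eq_toReal_iff' (PMF.apply_ne_top _ _) (PMF.apply_ne_top _ _), key h, key h']

/-! ### Kemeny's constant in terms of effective resistances -/

theorem exists_hitTime_potential {G : SimpleGraph V} (hG : G.Connected) (j : V) :
    ∃ h : V → ℝ, h j = 0 ∧ (∀ i, i ≠ j → lap G h i = deg G i) ∧
      ∀ i, h i = ∑ k, deg G k * (lapPinv G i k - lapPinv G i j - lapPinv G j k + lapPinv G j j) := by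
  classical
  -- The mass removed at `j` makes the sum zero, so that `L† g` solves `L f = g`; subtracting its
  -- value at `j` then normalises it.
  set g : V → ℝ := fun i => deg G i - (Pi.single j (∑ x, deg G x) : V → ℝ) i with hg
  have hg0 : ∑ i, g i = 0 := by simp [hg]
  have hX : ∀ i, (lapPinv G *ᵥ g) i = ∑ k, deg G k * (lapPinv G i k - lapPinv G i j) := by
    intro i
    simp only [Matrix.mulVec, dotProduct, hg, mul_sub, Finset.sum_sub_distrib, Pi.single_apply,
      mul_ite, mul_zero, Finset.sum_ite_eq', Finset.mem_univ, if_true]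
    rw [← Finset.sum_mul, mul_comm (lapPinv G i j)]
    simp only [mul_comm]
  refine ⟨fun i => (lapPinv G *ᵥ g) i - (lapPinv G *ᵥ g) j, sub_self _, fun i hi => ?_, fun i => ?_⟩
  · rw [lap_sub_const, lap_lapPinv hG hg0, hg]
    simp [hi]
  · dsimp only
    rw [hX, hX, ← Finset.sum_sub_distrib]
    exact Finset.sum_congr rfl fun k _ => by ring

theorem isKemenyConstant_of_deg_pos {G : SimpleGraph V} (hG : G.Connected)
    (hd : ∀ i, 0 < deg G i) :
    IsKemenyConstant G
      ((∑ i, ∑ j, deg G i * deg G j * effRes G i j) / (2 * ∑ i, deg G i)) := by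
  have : Nonempty V := hG.nonempty
  have hS : 0 < ∑ x, deg G x := Finset.sum_pos (fun x _ => hd x) Finset.univ_nonempty
  obtain ⟨π, hπ, hπd⟩ := exists_stationary hd
  refine ⟨π, hπ, fun π' h' => stationary_unique hG hd h' hπ, fun i => ?_⟩
  choose h hj hl hX using exists_hitTime_potential hG
  have hm : ∀ j, hitTime G i j = ENNReal.ofReal (h j i) := fun j =>
    hitTime_eq_ofReal hG hd (hj j) (hl j) i
  have h0 : ∀ j, 0 ≤ h j i := fun j => hj j ▸ le_of_lap_pos (fun x hx => hl j x hx ▸ hd x) i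
  have hn : ∀ j, 0 ≤ deg G j / (∑ x, deg G x) := fun j => div_nonneg (deg_nonneg G j) hS.le
  have hsum : ∑ j, π j * hitTime G i j =
      ENNReal.ofReal (∑ j, deg G j / (∑ x, deg G x) * h j i) := by
    rw [ENNReal.ofReal_sum_of_nonneg fun j _ => mul_nonneg (hn j) (h0 j)]
    refine Finset.sum_congr rfl fun j _ => ?_
    rw [hπd, hm, ENNReal.ofReal_mul (hn j)]
  rw [hsum, ENNReal.toReal_ofReal (Finset.sum_nonneg fun j _ => mul_nonneg (hn j) (h0 j))]
  refine ⟨ENNReal.ofReal_ne_top, ?_⟩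
  have e1 : ∑ j, deg G j / (∑ x, deg G x) * h j i = (∑ j, deg G j * h j i) / ∑ x, deg G x := by
    rw [Finset.sum_div]
    exact Finset.sum_congr rfl fun j _ => by ring
  -- With weights `d_j d_k`, exchanging `j` and `k` cancels the `L†_{ik}` and `L†_{ij}` terms of `h
  -- j i`. What remains, `L†_{jj} - L†_{jk}`, does not depend on `i` and symmetrises to half the
  -- resistance.
  have e2 : ∑ i, ∑ j, deg G i * deg G j * effRes G i j = 2 * ∑ j, deg G j * h j i := by
    have s1 : ∀ F : V → V → ℝ, ∑ j, ∑ k, deg G j * deg G k * F j k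
        = ∑ j, ∑ k, deg G j * deg G k * F k j := fun F => by
      rw [Finset.sum_comm]
      exact Finset.sum_congr rfl fun j _ => Finset.sum_congr rfl fun k _ => by ring
    have s2 := s1 fun j k => lapPinv G j j
    have s3 := s1 fun j k => lapPinv G j k
    have s4 := s1 fun j k => lapPinv G i j
    simp only [hX, effRes_eq, Finset.mul_sum, mul_add, mul_sub, ← mul_assoc,
      Finset.sum_add_distrib, Finset.sum_sub_distrib] at s2 s3 s4 ⊢
    simp only [← Finset.mul_sum, mul_assoc] at s2 s3 s4 ⊢
    linarith
  rw [e1, e2]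
  field_simp

theorem isKemenyConstant_of_subsingleton [Subsingleton V] [Nonempty V] (G : SimpleGraph V) :
    IsKemenyConstant G 0 := by
  have : Unique V := Classical.choice (nonempty_unique V)
  have hu : ∀ π π' : PMF V, π = π' := fun π π' => by
    ext i
    have h : ∀ ρ : PMF V, ρ i = 1 := fun ρ => by
      rw [← PMF.tsum_coe ρ, tsum_fintype, Fintype.sum_subsingleton _ i]
    rw [h, h]
  refine ⟨PMF.pure default, hu _ _, fun π' _ => hu _ _, fun i => ?_⟩
  have h : ∀ j, hitTime G i j = 0 := fun j => Subsingleton.elim i j ▸ hitTime_self G i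
  simp [h]

/-- Kemeny's constant of a connected graph is `(∑ i j, d_i d_j r(i, j)) / (4 m)`. -/
theorem isKemenyConstant_of_connected {G : SimpleGraph V} (hG : G.Connected) :
    IsKemenyConstant G
      ((∑ i, ∑ j, deg G i * deg G j * effRes G i j) / (2 * ∑ i, deg G i)) := by
  classical
  have := hG.nonempty
  cases subsingleton_or_nontrivial V with
  | inl h =>
    -- For one vertex the formula reads `0 / 0`, which is `0` by convention, the correct value.
    have e : ∀ i j, effRes G i j = 0 := fun i j => Subsingleton.elim i j ▸ effRes_self G i
    simpa [e] using isKemenyConstant_of_subsingleton G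
  | inr h =>
    refine isKemenyConstant_of_deg_pos hG fun i => ?_
    rw [deg, Nat.cast_pos]
    exact hG.preconnected.degree_pos_of_nontrivial i

end Walk

/-! ### Attaching pendant vertices -/

/-- `G` is `G₁` with the elements of `W` attached to `v` as pendant vertices. -/
structure IsPendantExtension {V W : Type*} (G₁ : SimpleGraph V) (v : V)
    (G : SimpleGraph (V ⊕ W)) : Prop where
  inl_inl (a b : V) : G.Adj (.inl a) (.inl b) ↔ G₁.Adj a b
  inl_inr (a : V) (y : W) : G.Adj (.inl a) (.inr y) ↔ a = v
  inr_inr (x y : W) : ¬ G.Adj (.inr x) (.inr y)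

/-- Reduces the one-sum to three adjacency rules, so that the leaves can be indexed by any finite
type. -/
theorem isPendantExtension_oneSum_starGraph {V U : Type*} (G₁ : SimpleGraph V) (v : V) (c : U) :
    IsPendantExtension G₁ v (oneSum G₁ (SimpleGraph.starGraph c) v c) where
  inl_inl _ _ := Iff.rfl
  inl_inr a y := by
    change a = v ∧ (SimpleGraph.starGraph c).Adj c y ↔ a = v
    simp [y.2.symm]
  inr_inr x y := by
    change ¬ (SimpleGraph.starGraph c).Adj x y
    simp [x.2, y.2]

namespace IsPendantExtension

variable {V W : Type*} {G₁ : SimpleGraph V} {v : V} {G : SimpleGraph (V ⊕ W)}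

theorem inr_inl (h : IsPendantExtension G₁ v G) (y : W) (a : V) :
    G.Adj (.inr y) (.inl a) ↔ a = v := by
  rw [G.adj_comm, h.inl_inr]

theorem connected (h : IsPendantExtension G₁ v G) (hG₁ : G₁.Connected) : G.Connected := by
  have : ∀ x, G.Reachable (.inl v) x := by
    rintro (a | y)
    · exact (hG₁ v a).map ⟨Sum.inl, fun hab => (h.inl_inl _ _).2 hab⟩
    · exact ((h.inl_inr v y).2 rfl).reachable
  have hne : Nonempty (V ⊕ W) := ⟨.inl v⟩
  exact ⟨fun x y => (this x).symm.trans (this y)⟩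

variable [Fintype V] [Fintype W]

open Classical in
theorem deg_inl (h : IsPendantExtension G₁ v G) (a : V) :
    deg G (.inl a) = deg G₁ a + if a = v then (Fintype.card W : ℝ) else 0 := by
  simp only [deg_eq_sum, Fintype.sum_sum_type, h.inl_inl, h.inl_inr]
  congr 1
  split_ifs <;> simp

theorem deg_inr (h : IsPendantExtension G₁ v G) (y : W) : deg G (.inr y) = 1 := by
  classical
  simp only [deg_eq_sum, Fintype.sum_sum_type, h.inr_inl, h.inr_inr]
  simp

open Classical in
theorem lap_inl (h : IsPendantExtension G₁ v G) (f : V ⊕ W → ℝ) (a : V) :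
    lap G f (.inl a) = lap G₁ (fun b => f (.inl b)) a +
      if a = v then ∑ y, (f (.inl v) - f (.inr y)) else 0 := by
  simp only [lap, Fintype.sum_sum_type, h.inl_inl, h.inl_inr]
  congr 1
  split_ifs with e
  · simp [e]
  · simp

theorem lap_inr (h : IsPendantExtension G₁ v G) (f : V ⊕ W → ℝ) (y : W) :
    lap G f (.inr y) = f (.inr y) - f (.inl v) := by
  classical
  simp [lap, Fintype.sum_sum_type, h.inr_inl, h.inr_inr]

/-- No current enters the leaves: the potential of `G₁` extends by the constant `f v`. -/
theorem effRes_inl_inl (h : IsPendantExtension G₁ v G) (hG₁ : G₁.Connected) (a b : V) :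
    effRes G (.inl a) (.inl b) = effRes G₁ a b := by
  classical
  obtain ⟨f, hf⟩ := exists_lap_eq hG₁ a b
  rw [effRes_eq_sub hf, effRes_eq_sub (f := Sum.elim f fun _ => f v)]
  · simp
  · ext (c | y)
    · simp [h.lap_inl, hf, Pi.single_apply]
    · simp [h.lap_inr]

/-- Series law: the unit current leaves `G₁` at `v` and drops the potential by `1` along the edge to
`y`. -/
theorem effRes_inl_inr (h : IsPendantExtension G₁ v G) (hG₁ : G₁.Connected) (a : V) (y : W) :
    effRes G (.inl a) (.inr y) = effRes G₁ a v + 1 := by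
  classical
  obtain ⟨f, hf⟩ := exists_lap_eq hG₁ a v
  rw [effRes_eq_sub hf,
    effRes_eq_sub (f := Sum.elim f fun x => f v - (Pi.single y 1 : W → ℝ) x)]
  · simp
    ring
  · ext (c | x)
    · by_cases hc : c = v <;> simp [h.lap_inl, hf, Pi.single_apply, hc]
    · simp [h.lap_inr, Pi.single_apply]

theorem effRes_inr_inr (h : IsPendantExtension G₁ v G) {x y : W} (hxy : x ≠ y) :
    effRes G (.inr x) (.inr y) = 2 := by
  classical
  -- The current runs from `x` through `v` to `y`, with `G₁` at potential `0`.
  rw [effRes_eq_sub (f := Sum.elim 0 (Pi.single x 1 - Pi.single y 1))]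
  · simp [hxy, hxy.symm]
    norm_num
  · ext (c | z)
    · have : lap G₁ (fun _ => (0 : ℝ)) c = 0 := by simp [lap]
      simp [h.lap_inl, this]
    · simp [h.lap_inr, Pi.single_apply]

theorem sum_deg (h : IsPendantExtension G₁ v G) :
    ∑ i, deg G i = ∑ a, deg G₁ a + 2 * Fintype.card W := by
  classical
  simp [Fintype.sum_sum_type, h.deg_inl, h.deg_inr, Finset.sum_add_distrib]
  ring

theorem sum_deg_mul_deg_mul_effRes (h : IsPendantExtension G₁ v G) (hG₁ : G₁.Connected) :
    ∑ i, ∑ j, deg G i * deg G j * effRes G i j =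
      ∑ a, ∑ b, deg G₁ a * deg G₁ b * effRes G₁ a b +
        4 * Fintype.card W * moment G₁ v + 2 * Fintype.card W * ∑ a, deg G₁ a +
        4 * (Fintype.card W : ℝ) ^ 2 - 2 * Fintype.card W := by
  classical
  set n : ℝ := (Fintype.card W : ℝ)
  have hm : moment G₁ v = ∑ a, deg G₁ a * effRes G₁ a v := by
    simp only [moment, deg]
  have hm' : moment G₁ v = ∑ a, deg G₁ a * effRes G₁ v a := by
    simp only [hm, effRes_comm G₁ v]
  -- The extra degree `n` at `v` adds `n μ` once per index; the `n²` term carries `r(v,v) = 0`.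
  have h1 : ∑ a, ∑ b, deg G (.inl a) * deg G (.inl b) * effRes G (.inl a) (.inl b) =
      ∑ a, ∑ b, deg G₁ a * deg G₁ b * effRes G₁ a b + 2 * n * moment G₁ v := by
    have e : ∀ a b, deg G (.inl a) * deg G (.inl b) * effRes G (.inl a) (.inl b) =
        deg G₁ a * deg G₁ b * effRes G₁ a b + (if b = v then n * (deg G₁ a * effRes G₁ a b) else 0)
          + (if a = v then n * (deg G₁ b * effRes G₁ a b) +
              (if b = v then n * n * effRes G₁ a b else 0) else 0) := by
      intro a b
      rw [h.deg_inl, h.deg_inl, h.effRes_inl_inl hG₁]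
      split_ifs <;> ring
    simp only [e, Finset.sum_add_distrib, Finset.sum_ite_eq', Finset.mem_univ, if_true,
      Finset.sum_ite_irrel, Finset.sum_const_zero, ← Finset.mul_sum, effRes_self]
    rw [← hm, ← hm']
    ring
  have h2 : ∑ a, ∑ y : W, deg G (.inl a) * deg G (.inr y) * effRes G (.inl a) (.inr y) =
      n * (∑ a, deg G₁ a + n + moment G₁ v) := by
    have e : ∀ a (y : W), deg G (.inl a) * deg G (.inr y) * effRes G (.inl a) (.inr y) =
        deg G₁ a * effRes G₁ a v + deg G₁ a + if a = v then n * (effRes G₁ a v + 1) else 0 := by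
      intro a y
      rw [h.deg_inl, h.deg_inr, h.effRes_inl_inr hG₁]
      split_ifs <;> ring
    simp only [e, Finset.sum_const, Finset.card_univ, nsmul_eq_mul, ← Finset.mul_sum,
      Finset.sum_add_distrib, Finset.sum_ite_eq', Finset.mem_univ, if_true, effRes_self]
    rw [← hm]
    ring
  have h3 : ∑ y : W, ∑ a, deg G (.inr y) * deg G (.inl a) * effRes G (.inr y) (.inl a) =
      n * (∑ a, deg G₁ a + n + moment G₁ v) := by
    rw [← h2, Finset.sum_comm]
    refine Finset.sum_congr rfl fun a _ => Finset.sum_congr rfl fun y _ => ?_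
    rw [effRes_comm]
    ring
  -- There are `n (n - 1)` ordered pairs of distinct leaves, each at resistance `2`.
  have h4 : ∑ x : W, ∑ y : W, deg G (.inr x) * deg G (.inr y) * effRes G (.inr x) (.inr y) =
      2 * n * n - 2 * n := by
    have e : ∀ x y : W, deg G (.inr x) * deg G (.inr y) * effRes G (.inr x) (.inr y) =
        2 - if x = y then 2 else 0 := by
      intro x y
      rw [h.deg_inr, h.deg_inr]
      split_ifs with hxy
      · rw [hxy, effRes_self]
        ring
      · rw [h.effRes_inr_inr hxy]
        ring
    simp only [e, Finset.sum_sub_distrib, Finset.sum_const, Finset.card_univ, nsmul_eq_mul,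
      Finset.sum_ite_eq, Finset.mem_univ, if_true]
    ring
  simp only [Fintype.sum_sum_type, Finset.sum_add_distrib]
  rw [h1, h2, h3, h4]
  ring

end IsPendantExtension

theorem sum_deg_eq {V : Type*} [Fintype V] (G : SimpleGraph V) :
    ∑ i, deg G i = 2 * G.edgeSet.ncard := by
  classical
  rw [← SimpleGraph.coe_edgeFinset, Set.ncard_coe_finset]
  simp only [deg]
  exact_mod_cast G.sum_degrees_eq_twice_card_edges

end Kemeny

theorem mainTheorem9 {V : Type*} [Fintype V] (G₁ : SimpleGraph V) (hG₁ : G₁.Connected) (v : V)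
    (k : ℕ) (hk : 0 < G₁.edgeSet.ncard + k) :
    ∃ κ₁ : ℝ, Kemeny.IsKemenyConstant G₁ κ₁ ∧
      Kemeny.IsKemenyConstant
        (Kemeny.oneSum G₁ (SimpleGraph.starGraph (0 : Fin (k + 1))) v (0 : Fin (k + 1)))
        (((G₁.edgeSet.ncard : ℝ) * κ₁ + (k : ℝ) * Kemeny.moment G₁ v
            + (k : ℝ) * ((G₁.edgeSet.ncard : ℝ) + (k : ℝ) - 1 / 2))
          / ((G₁.edgeSet.ncard : ℝ) + (k : ℝ))) := by
  refine ⟨_, Kemeny.isKemenyConstant_of_connected hG₁, ?_⟩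
  have h := Kemeny.isPendantExtension_oneSum_starGraph G₁ v (0 : Fin (k + 1))
  convert Kemeny.isKemenyConstant_of_connected (h.connected hG₁) using 1
  have hcard : Fintype.card {y : Fin (k + 1) // y ≠ 0} = k := by simp
  rw [h.sum_deg_mul_deg_mul_effRes hG₁, h.sum_deg, hcard, Kemeny.sum_deg_eq]
  have hk' : (0 : ℝ) < G₁.edgeSet.ncard + k := by exact_mod_cast hk
  -- If `G₁` has no edges, its Kemeny formula divides by zero; `m * (Q / (4 m)) = Q / 4` survives
  -- because `Q = 0` as well.
  have hm : (G₁.edgeSet.ncard : ℝ) = 0 →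
      ∑ a, ∑ b, Kemeny.deg G₁ a * Kemeny.deg G₁ b * Kemeny.effRes G₁ a b = 0 := by
    intro h0
    have hs := Kemeny.sum_deg_eq G₁
    rw [h0, mul_zero, Finset.sum_eq_zero_iff_of_nonneg fun i _ => Kemeny.deg_nonneg G₁ i] at hs
    simp [hs]
  generalize ∑ a, ∑ b, Kemeny.deg G₁ a * Kemeny.deg G₁ b * Kemeny.effRes G₁ a b = Q at hm ⊢
  generalize (G₁.edgeSet.ncard : ℝ) = m at hm hk' ⊢
  have hQ : m * (Q / (2 * (2 * m))) = Q / 4 := by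
    by_cases h0 : m = 0
    · simp [h0, hm h0]
    · field_simp
      ring
  rw [hQ, div_eq_div_iff hk'.ne' (by linarith)]
  ring
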